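/- Let $A=(a_{ij})\in\mathbb{R}^{n\times n}$ be an L-matrix (i.e. $a_{ij}\le 0$ for $i\ne j$ and $a_{ii}>0$) with unit diagonal, $a_{ii}=1$ for all $i$, and let $0<\omega\le 1$, $0\le\gamma\le 1$. For a matrix $B=D-L-U\in\mathbb{R}^{n\times n}$ with $D$ diagonal and invertible, $L$ strictly lower triangular and $U$ strictly upper triangular, let $$\mathscr{L}_{\gamma,\omega}(B)=(D-\gamma L)^{-1}\left[(1-\omega)D+(\omega-\gamma)L+\omega U\right]$$ denote its AOR iteration matrix, and let $\rho$ denote the spectral radius. Let $\alpha_{ij}$ $(1\le i,j\le n)$ be real numbers with $\alpha_{ii}=0$ and $\alpha_{ij}\ge 0$ for $i\ne j$, and put $Q_2=(-\alpha_{ij}a_{ij})$, $P_2=I+Q_2$, $A^{(2)}=P_2A$. Write $\mathscr{L}_{\gamma,\omega}=\mathscr{L}_{\gamma,\omega}(A)$ and $\mathscr{L}^{(2)}_{\gamma,\omega}=\mathscr{L}_{\gamma,\omega}(A^{(2)})$. Suppose that $$\sum_{k\ne i}\alpha_{ik}a_{ik}a_{ki}<1\quad\text{for every } i,$$ and $$(1-\alpha_{ij})a_{ij}-\sum_{k\ne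 i,j}\alpha_{ik}a_{ik}a_{kj}\le 0\quad\text{for all } i\ne j.$$ (The first condition says that $A^{(2)}$ has positive diagonal, so that $\mathscr{L}^{(2)}_{\gamma,\omega}$ is defined.) Then one of the following mutually exclusive relations is valid: (i) $\rho(\mathscr{L}^{(2)}_{\gamma,\omega})\le\rho(\mathscr{L}_{\gamma,\omega})<1$; (ii) $\rho(\mathscr{L}^{(2)}_{\gamma,\omega})=\rho(\mathscr{L}_{\gamma,\omega})=1$; (iii) $\rho(\mathscr{L}^{(2)}_{\gamma,\omega})\ge\rho(\mathscr{L}_{\gamma,\omega})>1$. -/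

import Mathlib

open scoped ENNReal

noncomputable section

namespace AOR

variable {n : ℕ}

/-- Z-matrix: all off-diagonal entries are nonpositive. -/
def IsZMatrix (B : Matrix (Fin n) (Fin n) ℝ) : Prop :=
  ∀ i j, i ≠ j → B i j ≤ 0

/-- L-matrix: a Z-matrix with positive diagonal entries. -/
def IsLMatrix (B : Matrix (Fin n) (Fin n) ℝ) : Prop :=
  IsZMatrix B ∧ ∀ i, 0 < B i i

/-- The diagonal part `D` in the decomposition `B = D - L - U`. -/
def diagPart (B : Matrix (Fin n) (Fin n) ℝ) : Matrix (Fin n) (Fin n) ℝ :=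
  Matrix.diagonal fun i => B i i

/-- The strictly lower triangular matrix `L` in `B = D - L - U` (note the sign). -/
def lowerPart (B : Matrix (Fin n) (Fin n) ℝ) : Matrix (Fin n) (Fin n) ℝ :=
  Matrix.of fun i j => if j < i then -B i j else 0

/-- The strictly upper triangular matrix `U` in `B = D - L - U` (note the sign). -/
def upperPart (B : Matrix (Fin n) (Fin n) ℝ) : Matrix (Fin n) (Fin n) ℝ :=
  Matrix.of fun i j => if i < j then -B i j else 0

/-- The AOR iteration matrix of `B`:
`(D - γ L)⁻¹ [(1 - ω) D + (ω - γ) L + ω U]`. -/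
def iterMatrix (γ ω : ℝ) (B : Matrix (Fin n) (Fin n) ℝ) : Matrix (Fin n) (Fin n) ℝ :=
  (diagPart B - γ • lowerPart B)⁻¹ *
    ((1 - ω) • diagPart B + (ω - γ) • lowerPart B + ω • upperPart B)

/-- The spectral radius `ρ(T)` of a real matrix: the largest modulus of a complex eigenvalue. -/
def rho (T : Matrix (Fin n) (Fin n) ℝ) : ℝ≥0∞ :=
  spectralRadius ℂ (T.map (algebraMap ℝ ℂ))

/-- The matrix `Q₂ = (-α_{ij} a_{ij})`. -/
def Q₂ (α A : Matrix (Fin n) (Fin n) ℝ) : Matrix (Fin n) (Fin n) ℝ :=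
  Matrix.of fun i j => -(α i j * A i j)

/-- The preconditioned matrix `A⁽²⁾ = P₂ A` with `P₂ = I + Q₂`. -/
def precond₂ (α A : Matrix (Fin n) (Fin n) ℝ) : Matrix (Fin n) (Fin n) ℝ :=
  (1 + Q₂ α A) * A

/-- One of the three propositions holds, and they are mutually exclusive. -/
def ExactlyOne (p q r : Prop) : Prop :=
  (p ∨ q ∨ r) ∧ ¬(p ∧ q) ∧ ¬(p ∧ r) ∧ ¬(q ∧ r)

end AOR

end

namespace AOR

open Matrix

variable {n : ℕ}

/-! ### Spectral radius of an entrywise nonnegative matrix -/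

/-! Write `M = D - γL`, so that the iteration matrix of `B` is `M⁻¹(M - ωB)`. For an L-matrix both
this matrix and `M⁻¹` are entrywise nonnegative, hence its spectral radius can be bounded by test
vectors: `(1 - s)Mx ≤ ωBx` with `x > 0` gives `ρ ≤ s`, and the reverse inequality with `0 ≠ x ≥ 0`
gives `ρ ≥ s`. No irreducibility is needed, because such vectors exist for every `s > ρ` (Gelfand's
formula) and for `s = ρ` (moduli of an eigenvector) respectively.

Preconditioning by `P = I + Q`, `Q ≥ 0`, keeps test vectors. If `x ≥ 0` and `Mx ≥ 0`, then `M₂x ≤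
PMx`, where `M₂` belongs to `PA` (`splitMatrix_precond₂_mulVec_le`). Multiplying a test inequality
for `A` by `P` therefore gives one for `PA`: an upper bound if `s ≤ 1`, a lower bound if `s ≥ 1`.
This settles `ρ < 1`, `ρ > 1` and half of `ρ = 1`.

The other half, that `ρ ≤ 1` is inherited, needs upper bounds with `s > 1`, where the sign of `1 -
s` is wrong. There `Ax ≥ -δx` is passed on to `PAx ≥ -εD₂x`, with `D₂` the diagonal of `PA`, and a
geometric reweighting of `x` absorbs the error (`rho_iterMatrix_le_of_neg_le_mulVec`). -/

theorem exists_eigenvector_of_mem_spectrum {B : Matrix (Fin n) (Fin n) ℂ} {z : ℂ}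
    (hz : z ∈ spectrum ℂ B) : ∃ v : Fin n → ℂ, v ≠ 0 ∧ B *ᵥ v = z • v := by
  rw [spectrum.mem_iff, Matrix.isUnit_iff_isUnit_det, isUnit_iff_ne_zero, not_not] at hz
  obtain ⟨v, hv, h⟩ := Matrix.exists_mulVec_eq_zero_iff.2 hz
  refine ⟨v, hv, ?_⟩
  rw [Matrix.sub_mulVec, sub_eq_zero, Algebra.algebraMap_eq_smul_one, Matrix.smul_mulVec,
    Matrix.one_mulVec] at h
  exact h.symm

theorem norm_mul_norm_le_mulVec_norm {G : Matrix (Fin n) (Fin n) ℝ} (hG : ∀ i j, 0 ≤ G i j)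
    {z : ℂ} {v : Fin n → ℂ} (hv : G.map (algebraMap ℝ ℂ) *ᵥ v = z • v) (i : Fin n) :
    ‖z‖ * ‖v i‖ ≤ (G *ᵥ fun j => ‖v j‖) i := by
  have h := congrFun hv i
  rw [Pi.smul_apply, smul_eq_mul] at h
  rw [← norm_mul, ← h, Matrix.mulVec_apply_eq_sum, Matrix.mulVec_apply_eq_sum]
  refine (norm_sum_le _ _).trans (Finset.sum_le_sum fun j _ => ?_)
  simp [abs_of_nonneg (hG i j)]

theorem exists_max_ratio {x y : Fin n → ℝ} (hx : ∀ i, 0 ≤ x i) (hx0 : x ≠ 0)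
    (hy : ∀ i, 0 < y i) : ∃ r i, 0 < r ∧ x i = r * y i ∧ ∀ j, x j ≤ r * y j := by
  obtain ⟨k, hk⟩ := Function.ne_iff.1 hx0
  have hk' : 0 < x k := lt_of_le_of_ne (hx k) (Ne.symm hk)
  have : Nonempty (Fin n) := ⟨k⟩
  obtain ⟨i, hi⟩ := Finite.exists_max fun j => x j / y j
  refine ⟨x i / y i, i, (div_pos hk' (hy k)).trans_le (hi k), ?_, fun j => ?_⟩
  · rw [div_mul_cancel₀ _ (hy i).ne']
  · exact (div_le_iff₀ (hy j)).1 (hi j)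

theorem mulVec_le_mulVec {G : Matrix (Fin n) (Fin n) ℝ} (hG : ∀ i j, 0 ≤ G i j)
    {x y : Fin n → ℝ} (h : ∀ i, x i ≤ y i) (i : Fin n) : (G *ᵥ x) i ≤ (G *ᵥ y) i := by
  simp only [Matrix.mulVec_apply_eq_sum]
  exact Finset.sum_le_sum fun j _ => mul_le_mul_of_nonneg_left (h j) (hG i j)

theorem mulVec_nonneg_of_nonneg {G : Matrix (Fin n) (Fin n) ℝ} (hG : ∀ i j, 0 ≤ G i j)
    {x : Fin n → ℝ} (h : ∀ i, 0 ≤ x i) (i : Fin n) : 0 ≤ (G *ᵥ x) i := by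
  rw [Matrix.mulVec_apply_eq_sum]
  exact Finset.sum_nonneg fun j _ => mul_nonneg (hG i j) (h j)

/-- A subinvariant and a superinvariant vector of a nonnegative matrix are comparable. -/
theorem le_of_subinvariant_of_superinvariant {G : Matrix (Fin n) (Fin n) ℝ}
    (hG : ∀ i j, 0 ≤ G i j) {x y : Fin n → ℝ} {r s : ℝ} (hx : ∀ i, 0 ≤ x i) (hx0 : x ≠ 0)
    (hxG : ∀ i, r * x i ≤ (G *ᵥ x) i) (hy : ∀ i, 0 < y i) (hyG : ∀ i, (G *ᵥ y) i ≤ s * y i) :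
    r ≤ s := by
  -- Scale `y` until it touches `x` from above; both hypotheses are compared at the contact index.
  obtain ⟨t, i, ht, hti, htj⟩ := exists_max_ratio hx hx0 hy
  have h1 : (G *ᵥ x) i ≤ t * (G *ᵥ y) i := by
    refine (mulVec_le_mulVec hG (y := t • y) htj i).trans_eq ?_
    rw [Matrix.mulVec_smul, Pi.smul_apply, smul_eq_mul]
  have h2 : r * (t * y i) ≤ s * (t * y i) := by
    rw [← hti]
    calc r * x i ≤ t * (G *ᵥ y) i := (hxG i).trans h1
      _ ≤ t * (s * y i) := mul_le_mul_of_nonneg_left (hyG i) ht.le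
      _ = s * x i := by rw [hti]; ring
  exact le_of_mul_le_mul_right h2 (mul_pos ht (hy i))

theorem rho_le_of_mulVec_le {G : Matrix (Fin n) (Fin n) ℝ} (hG : ∀ i j, 0 ≤ G i j)
    {y : Fin n → ℝ} {s : ℝ} (hy : ∀ i, 0 < y i) (hyG : ∀ i, (G *ᵥ y) i ≤ s * y i) :
    rho G ≤ ENNReal.ofReal s := by
  refine iSup₂_le fun z hz => ?_
  obtain ⟨v, hv0, hv⟩ := exists_eigenvector_of_mem_spectrum hz
  have h : ‖z‖ ≤ s := by
    refine le_of_subinvariant_of_superinvariant hG (x := fun j => ‖v j‖)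
      (fun i => norm_nonneg _) (fun h => hv0 ?_) (norm_mul_norm_le_mulVec_norm hG hv) hy hyG
    ext i
    simpa using congrFun h i
  exact (ofReal_norm z).symm.trans_le (ENNReal.ofReal_le_ofReal h)

section Norm

attribute [local instance] Matrix.linftyOpNormedRing Matrix.linftyOpNormedAlgebra

/-- The spectral radius of a nonnegative matrix admits a nonnegative subinvariant vector. -/
theorem exists_rho_mul_le_mulVec [NeZero n] {G : Matrix (Fin n) (Fin n) ℝ}
    (hG : ∀ i j, 0 ≤ G i j) : ∃ (r : ℝ) (x : Fin n → ℝ), rho G = ENNReal.ofReal r ∧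
      (∀ i, 0 ≤ x i) ∧ x ≠ 0 ∧ ∀ i, r * x i ≤ (G *ᵥ x) i := by
  obtain ⟨z, hz, hzr⟩ := spectrum.exists_nnnorm_eq_spectralRadius (G.map (algebraMap ℝ ℂ))
  obtain ⟨v, hv0, hv⟩ := exists_eigenvector_of_mem_spectrum hz
  refine ⟨‖z‖, fun j => ‖v j‖, ?_, fun i => norm_nonneg _, fun h => hv0 ?_,
    norm_mul_norm_le_mulVec_norm hG hv⟩
  · exact hzr.symm.trans (ofReal_norm z).symm
  · ext i
    simpa using congrFun h i

/-- Every number above the spectral radius of a nonnegative matrix admits a positive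
superinvariant vector. -/
theorem exists_mulVec_le_of_rho_lt {G : Matrix (Fin n) (Fin n) ℝ} (hG : ∀ i j, 0 ≤ G i j)
    {s : ℝ} (h : rho G < ENNReal.ofReal s) :
    ∃ y : Fin n → ℝ, (∀ i, 0 < y i) ∧ ∀ i, (G *ᵥ y) i ≤ s * y i := by
  have hs : 0 < s := ENNReal.ofReal_pos.1 (pos_of_gt h)
  have hlim := spectrum.pow_nnnorm_pow_one_div_tendsto_nhds_spectralRadius
    (G.map (algebraMap ℝ ℂ))
  -- By Gelfand's formula some power has `‖G ^ k‖ ≤ s ^ k`; in the row-sum norm this reads `G ^ k 1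
  -- ≤ s ^ k 1`.
  obtain ⟨k, hk, hk0⟩ :=
    ((hlim.eventually_lt_const h).and (Filter.eventually_gt_atTop 0)).exists
  have hk0' : (0 : ℝ) < k := by exact_mod_cast hk0
  have hnorm : ‖(G ^ k).map (algebraMap ℝ ℂ)‖ ≤ s ^ k := by
    have h1 := ENNReal.rpow_le_rpow hk.le hk0'.le
    rw [← ENNReal.rpow_mul, one_div_mul_cancel hk0'.ne', ENNReal.rpow_one,
      ENNReal.rpow_natCast, ← ENNReal.ofReal_pow hs.le] at h1
    rw [Matrix.map_pow, ← coe_nnnorm, ← Real.le_toNNReal_iff_coe_le (pow_nonneg hs.le k)]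
    exact ENNReal.coe_le_coe.1 h1
  have hpow : ∀ (m : ℕ) i j, 0 ≤ (G ^ m) i j := by
    intro m
    induction m with
    | zero =>
      intro i j
      rw [pow_zero, Matrix.one_apply]
      split_ifs <;> norm_num
    | succ m ih =>
      intro i j
      rw [pow_succ, Matrix.mul_apply]
      exact Finset.sum_nonneg fun l _ => mul_nonneg (ih i l) (hG l j)
  have hrow : ∀ i, ((G ^ k) *ᵥ 1) i ≤ s ^ k := by
    intro i
    refine le_trans ?_ hnorm
    have h1 : ∑ j, ‖(G ^ k).map (algebraMap ℝ ℂ) i j‖₊ ≤ ‖(G ^ k).map (algebraMap ℝ ℂ)‖₊ := by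
      rw [Matrix.linfty_opNNNorm_def]
      exact Finset.le_sup (f := fun i => ∑ j, ‖(G ^ k).map (algebraMap ℝ ℂ) i j‖₊)
        (Finset.mem_univ i)
    rw [← coe_nnnorm]
    refine le_trans (le_of_eq ?_) (NNReal.coe_le_coe.2 h1)
    rw [NNReal.coe_sum, Matrix.mulVec_apply_eq_sum]
    refine Finset.sum_congr rfl fun j _ => ?_
    simp [abs_of_nonneg (hpow k i j)]
  -- Telescoping gives `(G - s)Y = G ^ k - s ^ k`, so `Y 1` is superinvariant; its `m = 0` term
  -- makes it positive.
  let Y : Matrix (Fin n) (Fin n) ℝ :=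
    ∑ m ∈ Finset.range k, G ^ m * (algebraMap ℝ _ s) ^ (k - 1 - m)
  have hgeom : G * Y - algebraMap ℝ _ s * Y = G ^ k - (algebraMap ℝ _ s) ^ k := by
    rw [← sub_mul]
    exact Commute.mul_geom_sum₂ (Algebra.commutes s G).symm k
  refine ⟨Y *ᵥ 1, fun i => ?_, fun i => ?_⟩
  · have hterm : ∀ m, ((G ^ m * (algebraMap ℝ (Matrix (Fin n) (Fin n) ℝ) s) ^ (k - 1 - m)) *ᵥ
        (1 : Fin n → ℝ)) i = s ^ (k - 1 - m) * ((G ^ m) *ᵥ 1) i := by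
      intro m
      rw [← map_pow, Algebra.algebraMap_eq_smul_one, mul_smul_comm, mul_one,
        Matrix.smul_mulVec, Pi.smul_apply, smul_eq_mul]
    have hY : (Y *ᵥ 1) i = ∑ m ∈ Finset.range k, s ^ (k - 1 - m) * ((G ^ m) *ᵥ 1) i := by
      rw [Matrix.sum_mulVec, Finset.sum_apply]
      exact Finset.sum_congr rfl fun m _ => hterm m
    rw [hY]
    refine Finset.sum_pos' (fun m _ => mul_nonneg (pow_nonneg hs.le _)
      (mulVec_nonneg_of_nonneg (hpow m) (fun _ => zero_le_one) i)) ⟨0, by simpa using hk0, ?_⟩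
    rw [pow_zero, Matrix.one_mulVec, Pi.one_apply, mul_one]
    exact pow_pos hs _
  · have h1 := congrFun (congrArg (· *ᵥ (1 : Fin n → ℝ)) hgeom) i
    simp only [← map_pow] at h1
    simp only [Matrix.sub_mulVec, ← Matrix.mulVec_mulVec, Pi.sub_apply,
      Algebra.algebraMap_eq_smul_one, Matrix.smul_mulVec, Matrix.one_mulVec, Pi.smul_apply,
      smul_eq_mul, Pi.one_apply, mul_one] at h1
    linarith [hrow i]

end Norm

theorem le_rho_of_le_mulVec {G : Matrix (Fin n) (Fin n) ℝ} (hG : ∀ i j, 0 ≤ G i j)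
    {x : Fin n → ℝ} {r : ℝ} (hx : ∀ i, 0 ≤ x i) (hx0 : x ≠ 0)
    (hxG : ∀ i, r * x i ≤ (G *ᵥ x) i) : ENNReal.ofReal r ≤ rho G := by
  by_contra! h
  obtain ⟨s, hs, hsr⟩ := ENNReal.lt_iff_exists_nnreal_btwn.1 h
  rw [← ENNReal.ofReal_coe_nnreal] at hs hsr
  obtain ⟨y, hy, hyG⟩ := exists_mulVec_le_of_rho_lt hG hs
  have := le_of_subinvariant_of_superinvariant hG hx hx0 hxG hy hyG
  exact absurd (ENNReal.ofReal_le_ofReal this) (not_le.2 hsr)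

/-! ### The splitting behind the AOR iteration -/

/-- The entrywise weights that turn `B` into `D - γ L`. -/
noncomputable def splitWeight (γ : ℝ) (i j : Fin n) : ℝ :=
  if j = i then 1 else if j < i then γ else 0

/-- The matrix `D - γ L` of `B = D - L - U`. -/
noncomputable def splitMatrix (γ : ℝ) (B : Matrix (Fin n) (Fin n) ℝ) : Matrix (Fin n) (Fin n) ℝ :=
  Matrix.of fun i j => splitWeight γ i j * B i j

theorem splitWeight_self (γ : ℝ) (i : Fin n) : splitWeight γ i i = 1 := if_pos rfl

theorem splitWeight_of_lt (γ : ℝ) {i j : Fin n} (h : j < i) : splitWeight γ i j = γ := by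
  rw [splitWeight, if_neg h.ne, if_pos h]

theorem splitWeight_of_gt (γ : ℝ) {i j : Fin n} (h : i < j) : splitWeight γ i j = 0 := by
  rw [splitWeight, if_neg h.ne', if_neg h.not_gt]

theorem splitWeight_mem_Icc {γ : ℝ} (hγ : 0 ≤ γ ∧ γ ≤ 1) (i j : Fin n) :
    0 ≤ splitWeight γ i j ∧ splitWeight γ i j ≤ 1 := by
  unfold splitWeight
  split_ifs
  exacts [⟨zero_le_one, le_rfl⟩, hγ, ⟨le_rfl, zero_le_one⟩]

theorem splitMatrix_eq (γ : ℝ) (B : Matrix (Fin n) (Fin n) ℝ) :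
    diagPart B - γ • lowerPart B = splitMatrix γ B := by
  ext i j
  simp only [diagPart, lowerPart, splitMatrix, Matrix.sub_apply, Matrix.smul_apply,
    Matrix.of_apply, smul_eq_mul]
  rcases lt_trichotomy i j with h | rfl | h
  · simp [splitWeight_of_gt γ h, h.ne, h.not_gt]
  · simp [splitWeight_self]
  · simp [splitWeight_of_lt γ h, h.ne', h]

theorem iterMatrix_eq (γ ω : ℝ) (B : Matrix (Fin n) (Fin n) ℝ) :
    iterMatrix γ ω B = (splitMatrix γ B)⁻¹ * (splitMatrix γ B - ω • B) := by
  rw [iterMatrix, splitMatrix_eq]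
  congr 1
  ext i j
  simp only [diagPart, lowerPart, upperPart, splitMatrix, Matrix.sub_apply, Matrix.add_apply,
    Matrix.smul_apply, Matrix.of_apply, smul_eq_mul]
  rcases lt_trichotomy i j with h | rfl | h
  · simp [splitWeight_of_gt γ h, h.ne, h.not_gt, h]
  · simp [splitWeight_self]
    ring
  · simp [splitWeight_of_lt γ h, h.ne', h, h.not_gt]
    ring

/-! ### Test vectors for the AOR iteration of an L-matrix -/

section LMatrix

variable {B : Matrix (Fin n) (Fin n) ℝ} {γ ω : ℝ}

theorem isUnit_det_splitMatrix (hB : IsLMatrix B) (γ : ℝ) : IsUnit (splitMatrix γ B).det := by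
  rw [Matrix.det_of_isLowerTriangular, isUnit_iff_ne_zero]
  · refine Finset.prod_ne_zero_iff.2 fun i _ => ?_
    rw [splitMatrix, Matrix.of_apply, splitWeight_self, one_mul]
    exact (hB.2 i).ne'
  · intro i j h
    rw [splitMatrix, Matrix.of_apply, splitWeight_of_gt γ (by simpa using h), zero_mul]

theorem splitMatrix_mulVec_apply (γ : ℝ) (B : Matrix (Fin n) (Fin n) ℝ) (x : Fin n → ℝ)
    (i : Fin n) : (splitMatrix γ B *ᵥ x) i =
      B i i * x i + ∑ j ∈ Finset.univ.erase i, splitWeight γ i j * B i j * x j := by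
  rw [Matrix.mulVec_apply_eq_sum, ← Finset.add_sum_erase _ _ (Finset.mem_univ i)]
  simp [splitMatrix, splitWeight_self]

theorem splitMatrix_mulVec_le (hB : IsLMatrix B) (hγ : 0 ≤ γ ∧ γ ≤ 1) {x : Fin n → ℝ}
    (i : Fin n) (hx : ∀ j < i, 0 ≤ x j) : (splitMatrix γ B *ᵥ x) i ≤ B i i * x i := by
  rw [splitMatrix_mulVec_apply, add_le_iff_nonpos_right]
  refine Finset.sum_nonpos fun j hj => ?_
  have hji : j ≠ i := Finset.ne_of_mem_erase hj
  rcases hji.lt_or_gt with h | h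
  · exact mul_nonpos_of_nonpos_of_nonneg (mul_nonpos_of_nonneg_of_nonpos
      (splitWeight_mem_Icc hγ i j).1 (hB.1 i j hji.symm)) (hx j h)
  · rw [splitWeight_of_gt γ h, zero_mul, zero_mul]

/-- Forward substitution: the matrix is lower triangular with positive diagonal and nonpositive
entries below it. -/
theorem nonneg_of_splitMatrix_mulVec_nonneg (hB : IsLMatrix B) (hγ : 0 ≤ γ ∧ γ ≤ 1)
    {x : Fin n → ℝ} (hx : ∀ i, 0 ≤ (splitMatrix γ B *ᵥ x) i) (i : Fin n) : 0 ≤ x i := by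
  induction i using WellFoundedLT.induction with
  | _ i ih =>
    exact nonneg_of_mul_nonneg_right ((hx i).trans (splitMatrix_mulVec_le hB hγ i ih)) (hB.2 i)

theorem pos_of_splitMatrix_mulVec_pos (hB : IsLMatrix B) (hγ : 0 ≤ γ ∧ γ ≤ 1)
    {x : Fin n → ℝ} (hx : ∀ i, 0 < (splitMatrix γ B *ᵥ x) i) (i : Fin n) : 0 < x i := by
  have h0 := nonneg_of_splitMatrix_mulVec_nonneg hB hγ fun i => (hx i).le
  exact pos_of_mul_pos_right ((hx i).trans_le (splitMatrix_mulVec_le hB hγ i fun j _ => h0 j))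
    (hB.2 i).le

theorem splitMatrix_mulVec_inv (hB : IsLMatrix B) (γ : ℝ) (y : Fin n → ℝ) :
    splitMatrix γ B *ᵥ ((splitMatrix γ B)⁻¹ *ᵥ y) = y := by
  rw [Matrix.mulVec_mulVec, Matrix.mul_nonsing_inv _ (isUnit_det_splitMatrix hB γ),
    Matrix.one_mulVec]

theorem splitMatrix_inv_nonneg (hB : IsLMatrix B) (hγ : 0 ≤ γ ∧ γ ≤ 1) (i j : Fin n) :
    0 ≤ (splitMatrix γ B)⁻¹ i j := by
  have h := nonneg_of_splitMatrix_mulVec_nonneg (γ := γ) hB hγ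
    (x := (splitMatrix γ B)⁻¹ *ᵥ Pi.single j 1) (fun k => by
      rw [splitMatrix_mulVec_inv hB γ, Pi.single_apply]
      split_ifs <;> norm_num) i
  simpa using h

theorem le_splitMatrix (hB : IsLMatrix B) (hγ : 0 ≤ γ ∧ γ ≤ 1) (i j : Fin n) :
    0 ≤ (splitMatrix γ B - B) i j := by
  have h : (splitMatrix γ B - B) i j = (1 - splitWeight γ i j) * -B i j := by
    rw [Matrix.sub_apply, splitMatrix, Matrix.of_apply]
    ring
  rw [h]
  rcases eq_or_ne i j with rfl | hij
  · simp [splitWeight_self]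
  · exact mul_nonneg (sub_nonneg.2 (splitWeight_mem_Icc hγ i j).2)
      (neg_nonneg.2 (hB.1 i j hij))

theorem iterMatrix_nonneg (hB : IsLMatrix B) (hω : 0 < ω ∧ ω ≤ 1) (hγ : 0 ≤ γ ∧ γ ≤ 1)
    (i j : Fin n) : 0 ≤ iterMatrix γ ω B i j := by
  have h : iterMatrix γ ω B =
      (1 - ω) • (1 : Matrix (Fin n) (Fin n) ℝ) +
        ω • ((splitMatrix γ B)⁻¹ * (splitMatrix γ B - B)) := by
    rw [iterMatrix_eq, mul_sub, mul_sub,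
      Matrix.nonsing_inv_mul _ (isUnit_det_splitMatrix hB γ), Matrix.mul_smul]
    module
  rw [h, Matrix.add_apply, Matrix.smul_apply, Matrix.smul_apply, Matrix.mul_apply,
    Matrix.one_apply]
  refine add_nonneg (smul_nonneg (sub_nonneg.2 hω.2) (by split_ifs <;> norm_num))
    (smul_nonneg hω.1.le (Finset.sum_nonneg fun k _ => mul_nonneg
      (splitMatrix_inv_nonneg hB hγ i k) (le_splitMatrix hB hγ k j)))

/-- The iteration matrix conjugated by `D - γ L`. -/
noncomputable def conjIterMatrix (γ ω : ℝ) (B : Matrix (Fin n) (Fin n) ℝ) :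
    Matrix (Fin n) (Fin n) ℝ :=
  (splitMatrix γ B - ω • B) * (splitMatrix γ B)⁻¹

theorem conjIterMatrix_nonneg (hB : IsLMatrix B) (hω : 0 < ω ∧ ω ≤ 1) (hγ : 0 ≤ γ ∧ γ ≤ 1)
    (i j : Fin n) : 0 ≤ conjIterMatrix γ ω B i j := by
  have h : conjIterMatrix γ ω B =
      (1 - ω) • (1 : Matrix (Fin n) (Fin n) ℝ) +
        ω • ((splitMatrix γ B - B) * (splitMatrix γ B)⁻¹) := by
    rw [conjIterMatrix, sub_mul, sub_mul,
      Matrix.mul_nonsing_inv _ (isUnit_det_splitMatrix hB γ), Matrix.smul_mul]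
    module
  rw [h, Matrix.add_apply, Matrix.smul_apply, Matrix.smul_apply, Matrix.mul_apply,
    Matrix.one_apply]
  refine add_nonneg (smul_nonneg (sub_nonneg.2 hω.2) (by split_ifs <;> norm_num))
    (smul_nonneg hω.1.le (Finset.sum_nonneg fun k _ => mul_nonneg
      (le_splitMatrix hB hγ i k) (splitMatrix_inv_nonneg hB hγ k j)))

theorem rho_conjIterMatrix (hB : IsLMatrix B) (γ ω : ℝ) :
    rho (conjIterMatrix γ ω B) = rho (iterMatrix γ ω B) := by
  let f : Matrix (Fin n) (Fin n) ℝ →+* Matrix (Fin n) (Fin n) ℂ := (algebraMap ℝ ℂ).mapMatrix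
  let u : (Matrix (Fin n) (Fin n) ℝ)ˣ :=
    Matrix.nonsingInvUnit (splitMatrix γ B) (isUnit_det_splitMatrix hB γ)
  have h : conjIterMatrix γ ω B = u * iterMatrix γ ω B * (u⁻¹ : (Matrix (Fin n) (Fin n) ℝ)ˣ) := by
    have hu : ((u⁻¹ : (Matrix (Fin n) (Fin n) ℝ)ˣ) : Matrix (Fin n) (Fin n) ℝ) =
      (splitMatrix γ B)⁻¹ := rfl
    have hu' : (u : Matrix (Fin n) (Fin n) ℝ) = splitMatrix γ B := rfl
    rw [hu, hu', iterMatrix_eq, ← mul_assoc,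
      Matrix.mul_nonsing_inv _ (isUnit_det_splitMatrix hB γ), one_mul, conjIterMatrix]
  have h' : f (conjIterMatrix γ ω B) = (Units.map f.toMonoidHom u : (Matrix _ _ ℂ)ˣ) *
      f (iterMatrix γ ω B) * ((Units.map f.toMonoidHom u)⁻¹ : (Matrix (Fin n) (Fin n) ℂ)ˣ) := by
    rw [h, map_mul, map_mul]
    rfl
  change spectralRadius ℂ (f _) = spectralRadius ℂ (f _)
  rw [spectralRadius, h', spectrum.units_conjugate, spectralRadius]

theorem iterMatrix_mulVec (γ ω : ℝ) (B : Matrix (Fin n) (Fin n) ℝ) (x : Fin n → ℝ) :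
    iterMatrix γ ω B *ᵥ x =
      (splitMatrix γ B)⁻¹ *ᵥ (splitMatrix γ B *ᵥ x - ω • (B *ᵥ x)) := by
  rw [iterMatrix_eq, ← Matrix.mulVec_mulVec, Matrix.sub_mulVec, Matrix.smul_mulVec]

theorem splitMatrix_inv_mulVec_smul (hB : IsLMatrix B) (γ s : ℝ) (x : Fin n → ℝ) :
    (splitMatrix γ B)⁻¹ *ᵥ (s • (splitMatrix γ B *ᵥ x)) = s • x := by
  rw [Matrix.mulVec_smul, Matrix.mulVec_mulVec,
    Matrix.nonsing_inv_mul _ (isUnit_det_splitMatrix hB γ), Matrix.one_mulVec]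

theorem conjIterMatrix_mulVec (hB : IsLMatrix B) (γ ω : ℝ) (y : Fin n → ℝ) :
    conjIterMatrix γ ω B *ᵥ y = y - ω • (B *ᵥ ((splitMatrix γ B)⁻¹ *ᵥ y)) := by
  rw [conjIterMatrix, ← Matrix.mulVec_mulVec, Matrix.sub_mulVec, Matrix.smul_mulVec,
    splitMatrix_mulVec_inv hB γ]

/-- Applying `(D - γL)⁻¹ ≥ 0` to `h` makes `x` superinvariant for the iteration matrix. -/
theorem rho_iterMatrix_le (hB : IsLMatrix B) (hω : 0 < ω ∧ ω ≤ 1) (hγ : 0 ≤ γ ∧ γ ≤ 1)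
    {x : Fin n → ℝ} {s : ℝ} (hx : ∀ i, 0 < x i)
    (h : ∀ i, (1 - s) * (splitMatrix γ B *ᵥ x) i ≤ ω * (B *ᵥ x) i) :
    rho (iterMatrix γ ω B) ≤ ENNReal.ofReal s := by
  refine rho_le_of_mulVec_le (iterMatrix_nonneg hB hω hγ) hx fun i => ?_
  rw [← smul_eq_mul, ← Pi.smul_apply, ← splitMatrix_inv_mulVec_smul hB γ s x, iterMatrix_mulVec]
  refine mulVec_le_mulVec (splitMatrix_inv_nonneg hB hγ) (fun j => ?_) i
  simp only [Pi.sub_apply, Pi.smul_apply, smul_eq_mul]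
  linarith [h j]

theorem le_rho_iterMatrix (hB : IsLMatrix B) (hω : 0 < ω ∧ ω ≤ 1) (hγ : 0 ≤ γ ∧ γ ≤ 1)
    {x : Fin n → ℝ} {s : ℝ} (hx : ∀ i, 0 ≤ x i) (hx0 : x ≠ 0)
    (h : ∀ i, ω * (B *ᵥ x) i ≤ (1 - s) * (splitMatrix γ B *ᵥ x) i) :
    ENNReal.ofReal s ≤ rho (iterMatrix γ ω B) := by
  refine le_rho_of_le_mulVec (iterMatrix_nonneg hB hω hγ) hx hx0 fun i => ?_
  rw [← smul_eq_mul, ← Pi.smul_apply, ← splitMatrix_inv_mulVec_smul hB γ s x, iterMatrix_mulVec]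
  refine mulVec_le_mulVec (splitMatrix_inv_nonneg hB hγ) (fun j => ?_) i
  simp only [Pi.sub_apply, Pi.smul_apply, smul_eq_mul]
  linarith [h j]

/-- A test vector `y` of the conjugate matrix is used, with `x = (D - γL)⁻¹ y`: the sign of `(D -
γL)x = y` then comes for free, and the comparison with the preconditioned matrix depends on it. -/
theorem exists_of_rho_iterMatrix_lt (hB : IsLMatrix B) (hω : 0 < ω ∧ ω ≤ 1)
    (hγ : 0 ≤ γ ∧ γ ≤ 1) {s : ℝ} (h : rho (iterMatrix γ ω B) < ENNReal.ofReal s) :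
    ∃ x : Fin n → ℝ, (∀ i, 0 < x i) ∧ (∀ i, 0 ≤ (splitMatrix γ B *ᵥ x) i) ∧
      ∀ i, (1 - s) * (splitMatrix γ B *ᵥ x) i ≤ ω * (B *ᵥ x) i := by
  rw [← rho_conjIterMatrix hB] at h
  obtain ⟨y, hy, hyG⟩ := exists_mulVec_le_of_rho_lt (conjIterMatrix_nonneg hB hω hγ) h
  refine ⟨(splitMatrix γ B)⁻¹ *ᵥ y, pos_of_splitMatrix_mulVec_pos (γ := γ) hB hγ ?_, ?_, ?_⟩ <;>
    rw [splitMatrix_mulVec_inv hB]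
  · exact hy
  · exact fun i => (hy i).le
  · intro i
    have := hyG i
    rw [conjIterMatrix_mulVec hB, Pi.sub_apply, Pi.smul_apply, smul_eq_mul] at this
    linarith

theorem exists_rho_iterMatrix_eq [NeZero n] (hB : IsLMatrix B) (hω : 0 < ω ∧ ω ≤ 1)
    (hγ : 0 ≤ γ ∧ γ ≤ 1) : ∃ (r : ℝ) (x : Fin n → ℝ), rho (iterMatrix γ ω B) = ENNReal.ofReal r ∧
      (∀ i, 0 ≤ x i) ∧ x ≠ 0 ∧ (∀ i, 0 ≤ (splitMatrix γ B *ᵥ x) i) ∧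
      ∀ i, ω * (B *ᵥ x) i ≤ (1 - r) * (splitMatrix γ B *ᵥ x) i := by
  rw [← rho_conjIterMatrix hB]
  obtain ⟨r, y, hr, hy, hy0, hyG⟩ := exists_rho_mul_le_mulVec (conjIterMatrix_nonneg hB hω hγ)
  refine ⟨r, (splitMatrix γ B)⁻¹ *ᵥ y, hr, nonneg_of_splitMatrix_mulVec_nonneg (γ := γ) hB hγ ?_,
    fun h0 => hy0 ?_, ?_, ?_⟩
  · rwa [splitMatrix_mulVec_inv hB]
  · rw [← splitMatrix_mulVec_inv hB γ y, h0, Matrix.mulVec_zero]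
  · rwa [splitMatrix_mulVec_inv hB]
  · intro i
    rw [splitMatrix_mulVec_inv hB]
    have := hyG i
    rw [conjIterMatrix_mulVec hB, Pi.sub_apply, Pi.smul_apply, smul_eq_mul] at this
    linarith

end LMatrix

/-! ### The preconditioned matrix -/

section Precond

variable {A α : Matrix (Fin n) (Fin n) ℝ} {γ ω : ℝ}

theorem Q₂_nonneg (hA : IsLMatrix A) (hα_diag : ∀ i, α i i = 0)
    (hα_nonneg : ∀ i j, i ≠ j → 0 ≤ α i j) (i j : Fin n) : 0 ≤ Q₂ α A i j := by
  rw [Q₂, Matrix.of_apply, neg_nonneg]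
  rcases eq_or_ne i j with rfl | h
  · rw [hα_diag, zero_mul]
  · exact mul_nonpos_of_nonneg_of_nonpos (hα_nonneg i j h) (hA.1 i j h)

theorem precond₂_apply (α A : Matrix (Fin n) (Fin n) ℝ) (i j : Fin n) :
    precond₂ α A i j = A i j + ∑ k, Q₂ α A i k * A k j := by
  rw [precond₂, add_mul, one_mul, Matrix.add_apply, Matrix.mul_apply]

theorem isLMatrix_precond₂ (hdiag : ∀ i, A i i = 1) (hα_diag : ∀ i, α i i = 0)
    (h_pos : ∀ i, ∑ k with k ≠ i, α i k * A i k * A k i < 1)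
    (h_nonpos : ∀ i j, i ≠ j →
      (1 - α i j) * A i j - ∑ k with k ≠ i ∧ k ≠ j, α i k * A i k * A k j ≤ 0) :
    IsLMatrix (precond₂ α A) := by
  have hQ : ∀ i j, ∑ k, Q₂ α A i k * A k j = -∑ k with k ≠ i, α i k * A i k * A k j := by
    intro i j
    rw [Finset.sum_filter, ← Finset.sum_neg_distrib]
    refine Finset.sum_congr rfl fun k _ => ?_
    rcases eq_or_ne k i with rfl | hk
    · simp [Q₂, hα_diag]
    · simp [Q₂, hk]
  refine ⟨fun i j hij => ?_, fun i => ?_⟩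
  · have hs : ∑ k with k ≠ i, α i k * A i k * A k j =
        α i j * A i j + ∑ k with k ≠ i ∧ k ≠ j, α i k * A i k * A k j := by
      rw [← Finset.add_sum_erase (Finset.univ.filter (· ≠ i)) _ (a := j) (by simp [hij.symm]),
        hdiag j, mul_one]
      congr 2
      ext k
      simp [and_comm]
    rw [precond₂_apply, hQ, hs]
    linarith [h_nonpos i j hij]
  · rw [precond₂_apply, hQ, hdiag]
    linarith [h_pos i]

theorem precond₂_mulVec_apply (α A : Matrix (Fin n) (Fin n) ℝ) (x : Fin n → ℝ) (i : Fin n) :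
    (precond₂ α A *ᵥ x) i = (A *ᵥ x) i + ∑ k, Q₂ α A i k * (A *ᵥ x) k := by
  rw [precond₂, ← Matrix.mulVec_mulVec, Matrix.add_mulVec, Matrix.one_mulVec, Pi.add_apply,
    Matrix.mulVec_apply_eq_sum (Q₂ α A)]

theorem splitMatrix_precond₂_mulVec_apply (α A : Matrix (Fin n) (Fin n) ℝ) (x : Fin n → ℝ)
    (i : Fin n) : (splitMatrix γ (precond₂ α A) *ᵥ x) i =
      (splitMatrix γ A *ᵥ x) i +
        ∑ k, Q₂ α A i k * ∑ j, splitWeight γ i j * A k j * x j := by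
  simp only [Matrix.mulVec_apply_eq_sum, splitMatrix, Matrix.of_apply, precond₂_apply,
    Finset.mul_sum]
  rw [Finset.sum_comm, ← Finset.sum_add_distrib]
  refine Finset.sum_congr rfl fun j _ => ?_
  rw [mul_add, add_mul, Finset.mul_sum, Finset.sum_mul]
  congr 1
  exact Finset.sum_congr rfl fun k _ => by ring

/-- If `(D - γ L) x ≥ 0` then row `k` of `A` with the weights of another row `i` gives less. -/
theorem sum_splitWeight_le (hA : IsLMatrix A) (hγ : 0 ≤ γ ∧ γ ≤ 1) {x : Fin n → ℝ}
    (hx : ∀ i, 0 ≤ x i) (hMx : ∀ i, 0 ≤ (splitMatrix γ A *ᵥ x) i) (i k : Fin n) :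
    ∑ j, splitWeight γ i j * A k j * x j ≤ (splitMatrix γ A *ᵥ x) k := by
  -- For `i < k` only off-diagonal entries of row `k` survive, so the sum is nonpositive. For `k <
  -- i` the weights agree left of the diagonal; on it and to its right those of row `i` only lower
  -- the sum.
  rcases lt_trichotomy i k with hik | rfl | hki
  · refine le_trans (Finset.sum_nonpos fun j _ => ?_) (hMx k)
    rcases lt_or_ge i j with h | h
    · rw [splitWeight_of_gt γ h, zero_mul, zero_mul]
    · exact mul_nonpos_of_nonpos_of_nonneg (mul_nonpos_of_nonneg_of_nonpos
        (splitWeight_mem_Icc hγ i j).1 (hA.1 k j (h.trans_lt hik).ne')) (hx j)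
  · rw [Matrix.mulVec_apply_eq_sum]
    rfl
  · rw [Matrix.mulVec_apply_eq_sum]
    refine Finset.sum_le_sum fun j _ => ?_
    rw [splitMatrix, Matrix.of_apply]
    refine mul_le_mul_of_nonneg_right ?_ (hx j)
    rcases lt_trichotomy k j with h | rfl | h
    · rw [splitWeight_of_gt γ h, zero_mul]
      exact mul_nonpos_of_nonneg_of_nonpos (splitWeight_mem_Icc hγ i j).1 (hA.1 k j h.ne)
    · rw [splitWeight_self]
      exact mul_le_mul_of_nonneg_right (splitWeight_mem_Icc hγ i k).2 (hA.2 k).le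
    · rw [splitWeight_of_lt γ h, splitWeight_of_lt γ (h.trans hki)]

theorem splitMatrix_precond₂_mulVec_le (hA : IsLMatrix A) (hγ : 0 ≤ γ ∧ γ ≤ 1)
    (hQ : ∀ i j, 0 ≤ Q₂ α A i j) {x : Fin n → ℝ}
    (hx : ∀ i, 0 ≤ x i) (hMx : ∀ i, 0 ≤ (splitMatrix γ A *ᵥ x) i) (i : Fin n) :
    (splitMatrix γ (precond₂ α A) *ᵥ x) i ≤
      (splitMatrix γ A *ᵥ x) i + ∑ k, Q₂ α A i k * (splitMatrix γ A *ᵥ x) k := by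
  rw [splitMatrix_precond₂_mulVec_apply, add_le_add_iff_left]
  exact Finset.sum_le_sum fun k _ =>
    mul_le_mul_of_nonneg_left (sum_splitWeight_le hA hγ hx hMx i k) (hQ i k)

theorem superinvariant_precond₂ (hA : IsLMatrix A) (hγ : 0 ≤ γ ∧ γ ≤ 1)
    (hQ : ∀ i j, 0 ≤ Q₂ α A i j) {x : Fin n → ℝ} {s : ℝ} (hs : s ≤ 1)
    (hx : ∀ i, 0 ≤ x i) (hMx : ∀ i, 0 ≤ (splitMatrix γ A *ᵥ x) i)
    (h : ∀ i, (1 - s) * (splitMatrix γ A *ᵥ x) i ≤ ω * (A *ᵥ x) i) (i : Fin n) :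
    (1 - s) * (splitMatrix γ (precond₂ α A) *ᵥ x) i ≤ ω * (precond₂ α A *ᵥ x) i := by
  refine (mul_le_mul_of_nonneg_left (splitMatrix_precond₂_mulVec_le hA hγ hQ hx hMx i)
    (sub_nonneg.2 hs)).trans ?_
  rw [precond₂_mulVec_apply, mul_add, mul_add, Finset.mul_sum, Finset.mul_sum]
  refine add_le_add (h i) (Finset.sum_le_sum fun k _ => ?_)
  rw [mul_left_comm, mul_left_comm ω]
  exact mul_le_mul_of_nonneg_left (h k) (hQ i k)

theorem subinvariant_precond₂ (hA : IsLMatrix A) (hγ : 0 ≤ γ ∧ γ ≤ 1)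
    (hQ : ∀ i j, 0 ≤ Q₂ α A i j) {x : Fin n → ℝ} {s : ℝ} (hs : 1 ≤ s)
    (hx : ∀ i, 0 ≤ x i) (hMx : ∀ i, 0 ≤ (splitMatrix γ A *ᵥ x) i)
    (h : ∀ i, ω * (A *ᵥ x) i ≤ (1 - s) * (splitMatrix γ A *ᵥ x) i) (i : Fin n) :
    ω * (precond₂ α A *ᵥ x) i ≤ (1 - s) * (splitMatrix γ (precond₂ α A) *ᵥ x) i := by
  refine le_trans ?_ (mul_le_mul_of_nonpos_left
    (splitMatrix_precond₂_mulVec_le hA hγ hQ hx hMx i) (sub_nonpos.2 hs))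
  rw [precond₂_mulVec_apply, mul_add, mul_add, Finset.mul_sum, Finset.mul_sum]
  refine add_le_add (h i) (Finset.sum_le_sum fun k _ => ?_)
  rw [mul_left_comm, mul_left_comm (1 - s)]
  exact mul_le_mul_of_nonneg_left (h k) (hQ i k)

/-! ### Perturbation estimates for the critical case -/

/-- A positive vector that `B` almost keeps nonnegative, reweighted by powers of `1 + ε`, bounds
the spectral radius of the iteration matrix of `B`. -/
theorem rho_iterMatrix_le_of_neg_le_mulVec {B : Matrix (Fin n) (Fin n) ℝ} (hB : IsLMatrix B)
    (hω : 0 < ω ∧ ω ≤ 1) (hγ : 0 ≤ γ ∧ γ ≤ 1) {x : Fin n → ℝ} {ε s : ℝ} (hε : 0 ≤ ε)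
    (hs : (1 + ε) ^ n ≤ 1 + (s - 1) / ω) (hx : ∀ i, 0 < x i)
    (h : ∀ i, -(ε * (B i i * x i)) ≤ (B *ᵥ x) i) :
    rho (iterMatrix γ ω B) ≤ ENNReal.ofReal s := by
  set κ := 1 + ε with hκ
  set μ := 1 + (s - 1) / ω with hμ
  have hκ1 : 1 ≤ κ := by linarith
  have hμ1 : 1 ≤ μ := (one_le_pow₀ hκ1).trans hs
  have hκ0 : 0 < κ := by linarith
  have hsμ : 1 - s = ω * (1 - μ) := by
    have := hω.1.ne'
    rw [hμ]
    field_simp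
    ring
  refine rho_iterMatrix_le hB hω hγ (x := fun j => κ ^ (j : ℕ) * x j)
    (fun i => mul_pos (pow_pos hκ0 _) (hx i)) fun i => ?_
  rw [hsμ, mul_assoc]
  refine mul_le_mul_of_nonneg_left ?_ hω.1.le
  refine le_of_mul_le_mul_left ?_ hκ0
  -- Proved entry by entry. The diagonal gives equality, which is why `κ = 1 + ε`. Off the diagonal
  -- `B i j ≤ 0`, so its coefficient on the right must not exceed `μ * κ ^ i`: below the diagonal by
  -- `j + 1 ≤ i` and `γ ≤ 1`, above it by `κ ^ n ≤ μ`.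
  have key : μ * κ ^ (i : ℕ) * ((B *ᵥ x) i + ε * (B i i * x i)) ≤
      κ * ((B *ᵥ fun j => κ ^ (j : ℕ) * x j) i -
        (1 - μ) * (splitMatrix γ B *ᵥ fun j => κ ^ (j : ℕ) * x j) i) := by
    have e1 : ε * (B i i * x i) = ∑ j, if j = i then ε * (B j j * x j) else 0 := by simp
    rw [e1]
    simp only [Matrix.mulVec_apply_eq_sum, Finset.mul_sum, ← Finset.sum_add_distrib,
      ← Finset.sum_sub_distrib]
    refine Finset.sum_le_sum fun j _ => ?_
    rw [splitMatrix, Matrix.of_apply]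
    rcases eq_or_ne j i with rfl | hji
    · rw [if_pos rfl, splitWeight_self, hκ]
      apply le_of_eq
      ring
    · rw [if_neg hji, add_zero]
      have e2 : κ * (B i j * (κ ^ (j : ℕ) * x j) -
          (1 - μ) * (splitWeight γ i j * B i j * (κ ^ (j : ℕ) * x j))) =
          (1 + (μ - 1) * splitWeight γ i j) * κ ^ ((j : ℕ) + 1) * (B i j * x j) := by
        ring
      rw [e2]
      refine mul_le_mul_of_nonpos_right ?_
        (mul_nonpos_of_nonpos_of_nonneg (hB.1 i j hji.symm) (hx j).le)
      rcases hji.lt_or_gt with hlt | hgt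
      · rw [splitWeight_of_lt γ hlt]
        refine mul_le_mul ?_ (pow_le_pow_right₀ hκ1 hlt) (pow_nonneg hκ0.le _) (by linarith)
        nlinarith [hγ.2]
      · rw [splitWeight_of_gt γ hgt, mul_zero, add_zero, one_mul]
        calc κ ^ ((j : ℕ) + 1) ≤ κ ^ n := pow_le_pow_right₀ hκ1 j.2
          _ ≤ μ * 1 := by rwa [mul_one]
          _ ≤ μ * κ ^ (i : ℕ) := mul_le_mul_of_nonneg_left (one_le_pow₀ hκ1) (by linarith)
  have h0 : 0 ≤ μ * κ ^ (i : ℕ) * ((B *ᵥ x) i + ε * (B i i * x i)) :=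
    mul_nonneg (mul_nonneg (by linarith) (pow_nonneg hκ0.le _)) (by linarith [h i])
  linarith [h0.trans key]

/-- Since `Q ≤ c(I - A)` entrywise, `Qx ≤ c(x - Ax) ≤ c(1 + δ)x`, which controls the loss `δQx`
caused by multiplying with `I + Q`. -/
theorem precond₂_mulVec_ge (hA : IsLMatrix A) (hdiag : ∀ i, A i i = 1)
    (hQ : ∀ i j, 0 ≤ Q₂ α A i j) (hα_diag : ∀ i, α i i = 0) {c : ℝ} (hc : ∀ i j, α i j ≤ c)
    {x : Fin n → ℝ} {δ : ℝ} (hδ : 0 ≤ δ) (hx : ∀ i, 0 < x i)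
    (h : ∀ i, -(δ * x i) ≤ (A *ᵥ x) i) (i : Fin n) :
    -(δ * (1 + c * (1 + δ)) * x i) ≤ (precond₂ α A *ᵥ x) i := by
  have hc0 : 0 ≤ c := (hα_diag i).symm.trans_le (hc i i)
  have hQx : ∑ k, Q₂ α A i k * x k ≤ c * (1 + δ) * x i := by
    have h1 : ∑ k, Q₂ α A i k * x k ≤ c * (x i - (A *ᵥ x) i) := by
      have e : x i - (A *ᵥ x) i = ∑ k ∈ Finset.univ.erase i, -A i k * x k := by
        rw [Matrix.mulVec_apply_eq_sum, ← Finset.add_sum_erase _ _ (Finset.mem_univ i), hdiag]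
        simp
      rw [e, ← Finset.add_sum_erase _ _ (Finset.mem_univ i), Finset.mul_sum]
      have e0 : Q₂ α A i i = 0 := by simp [Q₂, hα_diag]
      rw [e0, zero_mul, zero_add]
      refine Finset.sum_le_sum fun k hk => ?_
      have hki : i ≠ k := (Finset.ne_of_mem_erase hk).symm
      rw [Q₂, Matrix.of_apply, ← mul_assoc, ← mul_neg]
      exact mul_le_mul_of_nonneg_right (mul_le_mul_of_nonneg_right (hc i k)
        (neg_nonneg.2 (hA.1 i k hki))) (hx k).le
    refine h1.trans ?_
    rw [mul_assoc]
    exact mul_le_mul_of_nonneg_left (by linarith [h i]) hc0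
  have hQA : -(δ * ∑ k, Q₂ α A i k * x k) ≤ ∑ k, Q₂ α A i k * (A *ᵥ x) k := by
    rw [Finset.mul_sum, ← Finset.sum_neg_distrib]
    refine Finset.sum_le_sum fun k _ => ?_
    rw [mul_left_comm, ← mul_neg]
    exact mul_le_mul_of_nonneg_left (h k) (hQ i k)
  rw [precond₂_mulVec_apply]
  have := mul_le_mul_of_nonneg_left hQx hδ
  linarith [h i]

/-! ### Comparison of the spectral radii below, above and at one -/

theorem rho_iterMatrix_precond₂_le_of_lt_one (hA : IsLMatrix A) (hP : IsLMatrix (precond₂ α A))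
    (hω : 0 < ω ∧ ω ≤ 1) (hγ : 0 ≤ γ ∧ γ ≤ 1) (hQ : ∀ i j, 0 ≤ Q₂ α A i j)
    (h : rho (iterMatrix γ ω A) < 1) :
    rho (iterMatrix γ ω (precond₂ α A)) ≤ rho (iterMatrix γ ω A) := by
  refine le_of_forall_gt_imp_ge_of_dense fun a ha => ?_
  obtain ⟨s, hs, hsa⟩ := ENNReal.lt_iff_exists_nnreal_btwn.1 (lt_min ha h)
  have hs1 : (s : ℝ) ≤ 1 := by exact_mod_cast (hsa.trans_le (min_le_right _ _)).le
  rw [← ENNReal.ofReal_coe_nnreal] at hs hsa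
  obtain ⟨x, hx, hMx, hxA⟩ := exists_of_rho_iterMatrix_lt hA hω hγ hs
  exact (rho_iterMatrix_le hP hω hγ hx (superinvariant_precond₂ hA hγ hQ hs1
    (fun i => (hx i).le) hMx hxA)).trans (hsa.le.trans (min_le_left _ _))

theorem le_rho_iterMatrix_precond₂_of_one_le (hA : IsLMatrix A)
    (hP : IsLMatrix (precond₂ α A)) (hω : 0 < ω ∧ ω ≤ 1) (hγ : 0 ≤ γ ∧ γ ≤ 1)
    (hQ : ∀ i j, 0 ≤ Q₂ α A i j) (h : 1 ≤ rho (iterMatrix γ ω A)) :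
    rho (iterMatrix γ ω A) ≤ rho (iterMatrix γ ω (precond₂ α A)) := by
  rcases Nat.eq_zero_or_pos n with rfl | hn
  · rw [Subsingleton.elim (precond₂ α A) A]
  have : NeZero n := ⟨hn.ne'⟩
  obtain ⟨r, x, hr, hx, hx0, hMx, hxA⟩ := exists_rho_iterMatrix_eq hA hω hγ
  rw [hr] at h ⊢
  exact le_rho_iterMatrix hP hω hγ hx hx0
    (subinvariant_precond₂ hA hγ hQ (ENNReal.one_le_ofReal.1 h) hx hMx hxA)

theorem rho_iterMatrix_precond₂_le_one (hA : IsLMatrix A) (hP : IsLMatrix (precond₂ α A))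
    (hdiag : ∀ i, A i i = 1) (hα_diag : ∀ i, α i i = 0)
    (hω : 0 < ω ∧ ω ≤ 1) (hγ : 0 ≤ γ ∧ γ ≤ 1) (hQ : ∀ i j, 0 ≤ Q₂ α A i j)
    (h : rho (iterMatrix γ ω A) ≤ 1) : rho (iterMatrix γ ω (precond₂ α A)) ≤ 1 := by
  refine le_of_forall_gt_imp_ge_of_dense fun a ha => ?_
  obtain ⟨s, hs, hsa⟩ := ENNReal.lt_iff_exists_nnreal_btwn.1 ha
  have hs1 : 1 < (s : ℝ) := by exact_mod_cast hs
  rw [← ENNReal.ofReal_coe_nnreal] at hsa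
  refine le_trans ?_ hsa.le
  obtain ⟨c, hc0, hc⟩ : ∃ c : ℝ, 0 ≤ c ∧ ∀ i j, α i j ≤ c := by
    obtain ⟨c, hc⟩ := (Set.finite_range fun p : Fin n × Fin n => α p.1 p.2).bddAbove
    exact ⟨max c 0, le_max_right _ _, fun i j => (hc ⟨(i, j), rfl⟩).trans (le_max_left _ _)⟩
  obtain ⟨d, hd0, hd⟩ : ∃ d : ℝ, 0 < d ∧ ∀ i, d ≤ precond₂ α A i i := by
    rcases isEmpty_or_nonempty (Fin n) with hn | hn
    · exact ⟨1, one_pos, fun i => hn.elim i⟩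
    · obtain ⟨i, hi⟩ := Finite.exists_min fun i => precond₂ α A i i
      exact ⟨_, hP.2 i, hi⟩
  obtain ⟨ε, hε, hε0⟩ : ∃ ε : ℝ, (1 + ε) ^ n < 1 + (s - 1) / ω ∧ 0 < ε := by
    have ht : Filter.Tendsto (fun ε : ℝ => (1 + ε) ^ n) (nhdsWithin 0 (Set.Ioi 0)) (nhds 1) := by
      have : Continuous fun ε : ℝ => (1 + ε) ^ n := by fun_prop
      simpa using (this.tendsto 0).mono_left nhdsWithin_le_nhds
    have h1 : (1 : ℝ) < 1 + (s - 1) / ω := by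
      linarith [div_pos (sub_pos.2 hs1) hω.1]
    exact ((ht.eventually_lt_const h1).and self_mem_nhdsWithin).exists
  -- The cap `δ ≤ 1` bounds the factor by `1 + 2c`; `d` turns the error relative to `x` into one
  -- relative to the diagonal of the preconditioned matrix.
  obtain ⟨δ, hδ0, hδ⟩ : ∃ δ : ℝ, 0 < δ ∧ δ * (1 + c * (1 + δ)) ≤ ε * d := by
    have hp : 0 < 1 + 2 * c := by linarith
    refine ⟨min 1 (ε * d / (1 + 2 * c)), lt_min one_pos (div_pos (mul_pos hε0 hd0) hp), ?_⟩
    have h1 := min_le_left 1 (ε * d / (1 + 2 * c))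
    have h2 := min_le_right 1 (ε * d / (1 + 2 * c))
    have h0 : 0 ≤ min 1 (ε * d / (1 + 2 * c)) :=
      le_min zero_le_one (div_pos (mul_pos hε0 hd0) hp).le
    set δ := min 1 (ε * d / (1 + 2 * c))
    calc δ * (1 + c * (1 + δ)) ≤ δ * (1 + 2 * c) := by
          refine mul_le_mul_of_nonneg_left ?_ h0
          nlinarith
      _ ≤ ε * d := (le_div_iff₀ hp).1 h2
  -- With `s = 1 + ωδ` the factor `ω` cancels, leaving `Ax ≥ -δMx ≥ -δx`.
  have hlt : rho (iterMatrix γ ω A) < ENNReal.ofReal (1 + ω * δ) := by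
    refine h.trans_lt ?_
    rw [ENNReal.one_lt_ofReal]
    linarith [mul_pos hω.1 hδ0]
  obtain ⟨x, hx, hMx, hxA⟩ := exists_of_rho_iterMatrix_lt hA hω hγ hlt
  have hAx : ∀ i, -(δ * x i) ≤ (A *ᵥ x) i := by
    intro i
    have h1 : (splitMatrix γ A *ᵥ x) i ≤ x i := by
      simpa [hdiag] using splitMatrix_mulVec_le hA hγ i fun j _ => (hx j).le
    have h2 : ω * -(δ * (splitMatrix γ A *ᵥ x) i) ≤ ω * (A *ᵥ x) i := by linarith [hxA i]
    linarith [le_of_mul_le_mul_left h2 hω.1, mul_le_mul_of_nonneg_left h1 hδ0.le]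
  refine rho_iterMatrix_le_of_neg_le_mulVec hP hω hγ hε0.le hε.le hx fun i => ?_
  refine le_trans ?_ (precond₂_mulVec_ge hA hdiag hQ hα_diag hc hδ0.le hx hAx i)
  rw [neg_le_neg_iff, ← mul_assoc]
  exact mul_le_mul_of_nonneg_right (hδ.trans (mul_le_mul_of_nonneg_left (hd i) hε0.le)) (hx i).le

end Precond

end AOR

theorem theorem3p5 {n : ℕ} (A α : Matrix (Fin n) (Fin n) ℝ) (γ ω : ℝ)
    (hω : 0 < ω ∧ ω ≤ 1) (hγ : 0 ≤ γ ∧ γ ≤ 1)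
    (hA : AOR.IsLMatrix A) (hdiag : ∀ i, A i i = 1)
    (hα_diag : ∀ i, α i i = 0) (hα_nonneg : ∀ i j, i ≠ j → 0 ≤ α i j)
    (h_pos : ∀ i, ∑ k with k ≠ i, α i k * A i k * A k i < 1)
    (h_nonpos : ∀ i j, i ≠ j →
      (1 - α i j) * A i j - ∑ k with k ≠ i ∧ k ≠ j, α i k * A i k * A k j ≤ 0) :
    AOR.ExactlyOne
      (AOR.rho (AOR.iterMatrix γ ω (AOR.precond₂ α A)) ≤ AOR.rho (AOR.iterMatrix γ ω A) ∧
        AOR.rho (AOR.iterMatrix γ ω A) < 1)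
      (AOR.rho (AOR.iterMatrix γ ω (AOR.precond₂ α A)) = AOR.rho (AOR.iterMatrix γ ω A) ∧
        AOR.rho (AOR.iterMatrix γ ω A) = 1)
      (AOR.rho (AOR.iterMatrix γ ω (AOR.precond₂ α A)) ≥ AOR.rho (AOR.iterMatrix γ ω A) ∧
        AOR.rho (AOR.iterMatrix γ ω A) > 1) := by
  have hP := AOR.isLMatrix_precond₂ hdiag hα_diag h_pos h_nonpos
  have hQ := AOR.Q₂_nonneg hA hα_diag hα_nonneg
  refine ⟨?_, fun h => h.1.2.ne h.2.2, fun h => h.1.2.not_gt h.2.2, fun h => h.2.2.ne' h.1.2⟩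
  rcases lt_trichotomy (AOR.rho (AOR.iterMatrix γ ω A)) 1 with h | h | h
  · exact Or.inl ⟨AOR.rho_iterMatrix_precond₂_le_of_lt_one hA hP hω hγ hQ h, h⟩
  · refine Or.inr (Or.inl ⟨le_antisymm ?_ ?_, h⟩)
    · rw [h]
      exact AOR.rho_iterMatrix_precond₂_le_one hA hP hdiag hα_diag hω hγ hQ h.le
    · exact AOR.le_rho_iterMatrix_precond₂_of_one_le hA hP hω hγ hQ h.ge
  · exact Or.inr (Or.inr ⟨AOR.le_rho_iterMatrix_precond₂_of_one_le hA hP hω hγ hQ h.le, h⟩)
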